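/- Let $\mathbf B$ be a pointed protomodular category, that is, a category with finite limits and a zero object in which every change-of-base functor between categories of points (split epimorphisms with a chosen section over a fixed object) reflects isomorphisms. A reflexive graph $d,c\colon C_1\to C_0$, $e\colon C_0\to C_1$ ($de=1=ce$) in $\mathbf B$ is a *Peiffer graph* if, for $k\colon X\to C_1$ the kernel of $d$ and $h=ck$, there is a morphism $\varphi\colon X\times X\to C_1$ with $\varphi\langle 1,0\rangle=k$ and $\varphi\langle 1,1\rangle=eh$; it is *multiplicative* if, for the pullback $C_2=C_1\times_{C_0}C_1$ of $d$ and $c$, there is a morphism $m\colon C_2\to C_1$ with $m\langle 1,ed\rangle=1$ and $m\langle ec,1\rangle=1$. An *exact patch* is a cospan $X\xrightarrow{k}Y\xleftarrow{s}B$ such that $(k,s)$ is jointly epimorphic and there is a (necessarily unique) $p\colon Y\to B$ with $ps=1_B$, $pk=0$ and $k$ the kernel of $p$. Assume that every Peiffer graph in $\mathbf B$ is multiplicative. Then giving an internal groupoid in $\mathbf B$ is to give an exact patch $X\xrightarrow{k}Y\xleftarrow{s}B$ together with a morphism $h\colon X\to B$ for which there exist (dashed) morphisms $\varphi\colon X\times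 X\to Y$ and $\psi\colon Y\to B\times B$ such that $$\varphi\langle 1,0\rangle=k,\qquad \varphi\langle 1,1\rangle=sh,\qquad \psi k=\langle 1,0\rangle h,\qquad \psi s=\langle 1,1\rangle .$$ Precisely: 1. For every internal groupoid with domain $d$, codomain $c$ and identity morphism $e$, the cospan $(\ker d,e)$ is an exact patch which, with $h=c\circ\ker d$, admits the two dashed morphisms; and this assignment is an equivalence from the category of internal groupoids and internal functors in $\mathbf B$ to the category of all such data $(k,s,h)$, whose morphisms are the triples $(X\to X',\,Y\to Y',\,B\to B')$ commuting with $k$, $s$ and $h$. 2. For a given exact patch $(k,s)$ with retraction $p$ and a given $h\colon X\to B$, the two dashed morphisms exist if and only if there is an internal groupoid with object of objects $B$, object of morphisms $Y$, domain $p$, identity morphism $s$ and a codomain $c$ such that $ck=h$; in that case $c$ and the groupoid structure are unique. -/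

import Mathlib

open CategoryTheory CategoryTheory.Limits

universe v u

namespace PtProto

/-- A category (with the pullbacks in question) is *protomodular* when, for every `h : E ⟶ B`,
pulling back along `h` reflects isomorphisms of points: if `f` is a morphism from the split
epimorphism `(p, s)` to the split epimorphism `(p', s')` over `B` and the morphism
`t : E ×_B Y ⟶ E ×_B Y'` induced by `f` is an isomorphism, then so is `f`. -/
class IsProtomodular (C : Type u) [Category.{v} C] : Prop where
  isIso_of_baseChange : ∀ {B E Y Y' Z Z' : C} (h : E ⟶ B)
    (p : Y ⟶ B) (s : B ⟶ Y) (p' : Y' ⟶ B) (s' : B ⟶ Y') (f : Y ⟶ Y')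
    (g : Z ⟶ Y) (q : Z ⟶ E) (g' : Z' ⟶ Y') (q' : Z' ⟶ E) (t : Z ⟶ Z'),
    s ≫ p = 𝟙 B → s' ≫ p' = 𝟙 B → f ≫ p' = p → s ≫ f = s' →
    IsPullback g q p h → IsPullback g' q' p' h →
    t ≫ g' = g ≫ f → t ≫ q' = q → IsIso t → IsIso f

section Patch

variable {C : Type u} [Category.{v} C]

/-- The cospan `X ⟶ Y ⟵ B` is jointly epimorphic. -/
def JointlyEpic {X Y B : C} (k : X ⟶ Y) (s : B ⟶ Y) : Prop :=
  ∀ ⦃Z : C⦄ (a b : Y ⟶ Z), k ≫ a = k ≫ b → s ≫ a = s ≫ b → a = b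

variable [HasZeroMorphisms C]

/-- The cospan `(k, s)` is a (right) patch, with (necessarily unique) retraction `p`. -/
structure IsPatch {X Y B : C} (k : X ⟶ Y) (s : B ⟶ Y) (p : Y ⟶ B) : Prop where
  jointlyEpic : JointlyEpic k s
  s_p : s ≫ p = 𝟙 B
  k_p : k ≫ p = 0

/-- A patch is exact when `k` is the kernel of `p`. -/
structure IsExactPatch {X Y B : C} (k : X ⟶ Y) (s : B ⟶ Y) (p : Y ⟶ B) : Prop
    extends IsPatch k s p where
  isKernel : Nonempty (IsLimit (KernelFork.ofι k k_p))

/-- The two dashed arrows `X × X ⟶ Y` and `Y ⟶ B × B` can be inserted in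
```
X --⟨1,0⟩--> X × X <--⟨1,1⟩-- X
‖              ¦              | h
X -----k-----> Y <-----s----- B
| h            ¦              ‖
B --⟨1,0⟩--> B × B <--⟨1,1⟩-- B
```
so as to make it commutative. -/
def HasDashedArrows [HasBinaryProducts C] {X Y B : C}
    (k : X ⟶ Y) (s : B ⟶ Y) (h : X ⟶ B) : Prop :=
  (∃ φ : X ⨯ X ⟶ Y, prod.lift (𝟙 X) 0 ≫ φ = k ∧ prod.lift (𝟙 X) (𝟙 X) ≫ φ = h ≫ s) ∧
  (∃ ψ : Y ⟶ B ⨯ B, k ≫ ψ = h ≫ prod.lift (𝟙 B) 0 ∧ s ≫ ψ = prod.lift (𝟙 B) (𝟙 B))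

end Patch

/-- A reflexive graph: `d` is the domain, `c` the codomain and `e` the identity. -/
structure ReflexiveGraph (C : Type u) [Category.{v} C] where
  C₀ : C
  C₁ : C
  d : C₁ ⟶ C₀
  c : C₁ ⟶ C₀
  e : C₀ ⟶ C₁
  e_d : e ≫ d = 𝟙 C₀
  e_c : e ≫ c = 𝟙 C₀

namespace ReflexiveGraph

variable {C : Type u} [Category.{v} C] (Γ : ReflexiveGraph C)

section Mul

variable [HasPullbacks C]

/-- `x ↦ (x, 1)`, into the object `C₁ ×_{C₀} C₁` of the composable pairs `(x, y)`, those with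
`d x = c y`. -/
noncomputable def e₁ : Γ.C₁ ⟶ pullback Γ.d Γ.c :=
  pullback.lift (𝟙 Γ.C₁) (Γ.d ≫ Γ.e) (by simp [Γ.e_c])

/-- `y ↦ (1, y)` -/
noncomputable def e₂ : Γ.C₁ ⟶ pullback Γ.d Γ.c :=
  pullback.lift (Γ.c ≫ Γ.e) (𝟙 Γ.C₁) (by simp [Γ.e_d])

/-- A multiplicative graph: there is a unital multiplication on composable pairs. -/
def IsMultiplicative : Prop :=
  ∃ m : pullback Γ.d Γ.c ⟶ Γ.C₁, Γ.e₁ ≫ m = 𝟙 Γ.C₁ ∧ Γ.e₂ ≫ m = 𝟙 Γ.C₁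

/-- An internal groupoid structure on a reflexive graph; the multiplication is `(x, y) ↦ x y`,
where `d x = c y`. -/
@[ext]
structure GroupoidStr where
  m : pullback Γ.d Γ.c ⟶ Γ.C₁
  inv : Γ.C₁ ⟶ Γ.C₁
  m_d : m ≫ Γ.d = pullback.snd Γ.d Γ.c ≫ Γ.d
  m_c : m ≫ Γ.c = pullback.fst Γ.d Γ.c ≫ Γ.c
  e₁_m : Γ.e₁ ≫ m = 𝟙 Γ.C₁
  e₂_m : Γ.e₂ ≫ m = 𝟙 Γ.C₁
  /-- `(x y) z = x (y z)` for generalized elements. -/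
  assoc : ∀ {T : C} (x y z : T ⟶ Γ.C₁) (hxy : x ≫ Γ.d = y ≫ Γ.c) (hyz : y ≫ Γ.d = z ≫ Γ.c),
    pullback.lift (pullback.lift x y hxy ≫ m) z (by simp [m_d, hyz, pullback.lift_snd_assoc]) ≫ m =
      pullback.lift x (pullback.lift y z hyz ≫ m) (by simp [m_c, hxy, pullback.lift_fst_assoc]) ≫ m
  inv_d : inv ≫ Γ.d = Γ.c
  inv_c : inv ≫ Γ.c = Γ.d
  inv_m : pullback.lift inv (𝟙 Γ.C₁) (by simp [inv_d]) ≫ m = Γ.d ≫ Γ.e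
  m_inv : pullback.lift (𝟙 Γ.C₁) inv (by simp [inv_c]) ≫ m = Γ.c ≫ Γ.e

end Mul

/-- A Peiffer graph: for `k : X ⟶ C₁` the kernel of the domain morphism and `h = c k`, the pair
`(k, e h)` extends along `⟨1, 0⟩, ⟨1, 1⟩ : X ⟶ X × X`. -/
def IsPeiffer [HasZeroMorphisms C] [HasKernels C] [HasBinaryProducts C] : Prop :=
  ∃ φ : kernel Γ.d ⨯ kernel Γ.d ⟶ Γ.C₁,
    prod.lift (𝟙 (kernel Γ.d)) 0 ≫ φ = kernel.ι Γ.d ∧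
    prod.lift (𝟙 (kernel Γ.d)) (𝟙 (kernel Γ.d)) ≫ φ = (kernel.ι Γ.d ≫ Γ.c) ≫ Γ.e

end ReflexiveGraph

/-- An internal groupoid. -/
structure InternalGroupoid (C : Type u) [Category.{v} C] [HasPullbacks C] extends
    ReflexiveGraph C where
  str : toReflexiveGraph.GroupoidStr

namespace InternalGroupoid

variable {C : Type u} [Category.{v} C] [HasPullbacks C]

/-- An internal functor between internal groupoids. -/
@[ext]
structure Hom (G H : InternalGroupoid C) where
  f₀ : G.C₀ ⟶ H.C₀
  f₁ : G.C₁ ⟶ H.C₁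
  comm_d : f₁ ≫ H.d = G.d ≫ f₀
  comm_c : f₁ ≫ H.c = G.c ≫ f₀
  comm_e : G.e ≫ f₁ = f₀ ≫ H.e
  comm_m : G.str.m ≫ f₁ =
    pullback.lift (pullback.fst G.d G.c ≫ f₁) (pullback.snd G.d G.c ≫ f₁)
      (by simp only [Category.assoc, comm_d, comm_c]; rw [pullback.condition_assoc]) ≫ H.str.m

noncomputable instance : Category (InternalGroupoid C) where
  Hom := Hom
  id G :=
    { f₀ := 𝟙 _
      f₁ := 𝟙 _
      comm_d := by simp
      comm_c := by simp
      comm_e := by simp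
      comm_m := by
        rw [Category.comp_id]
        conv_lhs => rw [← Category.id_comp G.str.m]
        congr 1
        apply pullback.hom_ext <;> simp }
  comp F F' :=
    { f₀ := F.f₀ ≫ F'.f₀
      f₁ := F.f₁ ≫ F'.f₁
      comm_d := by rw [Category.assoc, F'.comm_d, ← Category.assoc, F.comm_d, Category.assoc]
      comm_c := by rw [Category.assoc, F'.comm_c, ← Category.assoc, F.comm_c, Category.assoc]
      comm_e := by rw [← Category.assoc, F.comm_e, Category.assoc, F'.comm_e, Category.assoc]
      comm_m := by
        rw [← Category.assoc, F.comm_m, Category.assoc, F'.comm_m, ← Category.assoc]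
        congr 1
        apply pullback.hom_ext
        · rw [Category.assoc, pullback.lift_fst, pullback.lift_fst_assoc, pullback.lift_fst,
            Category.assoc]
        · rw [Category.assoc, pullback.lift_snd, pullback.lift_snd_assoc, pullback.lift_snd,
            Category.assoc] }
  id_comp _ := Hom.ext (Category.id_comp _) (Category.id_comp _)
  comp_id _ := Hom.ext (Category.comp_id _) (Category.comp_id _)
  assoc _ _ _ := Hom.ext (Category.assoc _ _ _) (Category.assoc _ _ _)

end InternalGroupoid

/-- A cospan `X ⟶ Y ⟵ B` together with a morphism `h : X ⟶ B`. -/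
structure CospanWithMap (C : Type u) [Category.{v} C] where
  X : C
  Y : C
  B : C
  k : X ⟶ Y
  s : B ⟶ Y
  h : X ⟶ B

namespace CospanWithMap

variable {C : Type u} [Category.{v} C]

/-- Morphisms are the triples of morphisms commuting with `k`, `s` and `h`. -/
@[ext]
structure Hom (D D' : CospanWithMap C) where
  fX : D.X ⟶ D'.X
  fY : D.Y ⟶ D'.Y
  fB : D.B ⟶ D'.B
  comm_k : D.k ≫ fY = fX ≫ D'.k
  comm_s : D.s ≫ fY = fB ≫ D'.s
  comm_h : D.h ≫ fB = fX ≫ D'.h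

instance : Category (CospanWithMap C) where
  Hom := Hom
  id D :=
    { fX := 𝟙 _
      fY := 𝟙 _
      fB := 𝟙 _
      comm_k := by simp
      comm_s := by simp
      comm_h := by simp }
  comp f g :=
    { fX := f.fX ≫ g.fX
      fY := f.fY ≫ g.fY
      fB := f.fB ≫ g.fB
      comm_k := by rw [← Category.assoc, f.comm_k, Category.assoc, g.comm_k, Category.assoc]
      comm_s := by rw [← Category.assoc, f.comm_s, Category.assoc, g.comm_s, Category.assoc]
      comm_h := by rw [← Category.assoc, f.comm_h, Category.assoc, g.comm_h, Category.assoc] }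
  id_comp _ := Hom.ext (Category.id_comp _) (Category.id_comp _) (Category.id_comp _)
  comp_id _ := Hom.ext (Category.comp_id _) (Category.comp_id _) (Category.comp_id _)
  assoc _ _ _ := Hom.ext (Category.assoc _ _ _) (Category.assoc _ _ _) (Category.assoc _ _ _)

/-- The cospan is an exact patch and, with `h`, it admits the two dashed arrows. -/
def isPeifferPatch (C : Type u) [Category.{v} C] [HasZeroMorphisms C] [HasBinaryProducts C] :
    ObjectProperty (CospanWithMap C) :=
  fun D => (∃ p : D.Y ⟶ D.B, IsExactPatch D.k D.s p) ∧ HasDashedArrows D.k D.s D.h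

end CospanWithMap

/-- The functor sending an internal groupoid to the cospan formed by the kernel
`k : ker d ⟶ C₁` and the identity morphism `e : C₀ ⟶ C₁`, with `h = c k`. -/
noncomputable def normalization (C : Type u) [Category.{v} C] [HasZeroMorphisms C]
    [HasKernels C] [HasPullbacks C] : InternalGroupoid C ⥤ CospanWithMap C where
  obj G :=
    { X := kernel G.d
      Y := G.C₁
      B := G.C₀
      k := kernel.ι G.d
      s := G.e
      h := kernel.ι G.d ≫ G.c }
  map {G H} F :=
    { fX := kernel.map G.d H.d F.f₁ F.f₀ F.comm_d.symm
      fY := F.f₁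
      fB := F.f₀
      comm_k := by simp
      comm_s := F.comm_e
      comm_h := by simp [F.comm_c] }
  map_id G := by
    apply CospanWithMap.Hom.ext
    · refine (cancel_mono (kernel.ι G.d)).1 ?_
      exact (kernel.lift_ι _ _ _).trans ((Category.comp_id _).trans (Category.id_comp _).symm)
    · rfl
    · rfl
  map_comp {G H K} F F' := by
    apply CospanWithMap.Hom.ext
    · refine (cancel_mono (kernel.ι K.d)).1 ?_
      change kernel.map _ _ (F.f₁ ≫ F'.f₁) (F.f₀ ≫ F'.f₀) (F ≫ F').comm_d.symm ≫ _ =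
        (kernel.map _ _ F.f₁ F.f₀ F.comm_d.symm ≫ kernel.map _ _ F'.f₁ F'.f₀ F'.comm_d.symm) ≫ _
      simp
    · rfl
    · rfl

end PtProto

open PtProto

/-! Protomodularity enters in two ways. If a split epimorphism with section `s` is pulled back, the
projection `g` to its total object is jointly epic with `s` (`jointlyEpic_of_isPullback`). Hence a
split epimorphism with its kernel is an exact patch, the pairs `(1, y)` and `(x, 1)` jointly cover
the composable pairs, and the triples `(1, y, z)` and `(x, y, 1)` cover the composable triples. So a
unital multiplication is unique, respects `d` and `c`, and is associative. Moreover the shear `(x,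
y) ↦ (x, x y)` restricts to the identity over `x = 1`, so it is invertible (`isIso_shear`), which
yields inverses. A multiplicative graph is therefore a groupoid in exactly one way.

Given an exact patch with dashed arrows, the first component of `ψ` serves as codomain, and `φ` says
that the resulting reflexive graph is Peiffer, hence multiplicative by assumption, hence a groupoid.
Conversely a groupoid supplies `φ(x, y) = x y⁻¹` and `ψ = ⟨c, d⟩`. Functoriality can likewise be
tested on jointly epic pairs, so normalization is fully faithful. -/

namespace PtProto

/-! ### Joint epimorphicity from protomodularity -/

section JointlyEpic

variable {C : Type u} [Category.{v} C]

/-- In a protomodular category the projection of a base change of a split epimorphism is jointly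
epimorphic with the section. -/
theorem jointlyEpic_of_isPullback [HasEqualizers C] [IsProtomodular C] {B E Y Z : C}
    {g : Z ⟶ Y} {q : Z ⟶ E} {p : Y ⟶ B} {h : E ⟶ B} (hP : IsPullback g q p h)
    {s : B ⟶ Y} (hs : s ≫ p = 𝟙 B) : JointlyEpic g s := by
  intro W a b hg hsab
  -- The equalizer of `a` and `b` contains the section, and `g` factors through it. Its base change
  -- along `h` is therefore all of `Z`, so base change inverts its inclusion.
  have hP' : IsPullback (equalizer.lift g hg) q (equalizer.ι a b ≫ p) h := by
    refine ⟨⟨by simpa using hP.w⟩, ⟨PullbackCone.IsLimit.mk _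
      (fun c => hP.lift (c.fst ≫ equalizer.ι a b) c.snd (by simpa using c.condition)) ?_ ?_ ?_⟩⟩
    · intro c
      apply equalizer.hom_ext
      simp
    · intro c
      simp
    · intro c l h₁ h₂
      apply hP.hom_ext
      · simp [← h₁]
      · simp [h₂]
  have : IsIso (equalizer.ι a b) :=
    IsProtomodular.isIso_of_baseChange h (equalizer.ι a b ≫ p) (equalizer.lift s hsab) p s
      (equalizer.ι a b) (equalizer.lift g hg) q g q (𝟙 Z) (by simpa using hs) hs rfl (by simp)
      hP' hP (by simp) (by simp) inferInstance
  exact (cancel_epi (equalizer.ι a b)).1 (equalizer.condition a b)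

theorem isPullback_of_exists_lift {P X Y Z : C} {fst : P ⟶ X} {snd : P ⟶ Y} {f : X ⟶ Z} {g : Y ⟶ Z}
    (w : fst ≫ f = snd ≫ g)
    (exists_lift : ∀ ⦃T : C⦄ (x : T ⟶ X) (y : T ⟶ Y), x ≫ f = y ≫ g →
      ∃ l : T ⟶ P, l ≫ fst = x ∧ l ≫ snd = y)
    (hom_ext : ∀ ⦃T : C⦄ (a b : T ⟶ P), a ≫ fst = b ≫ fst → a ≫ snd = b ≫ snd → a = b) :
    IsPullback fst snd f g := by
  choose l h₁ h₂ using exists_lift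
  exact ⟨⟨w⟩, ⟨PullbackCone.IsLimit.mk w (fun c => l c.fst c.snd c.condition)
    (fun c => h₁ _ _ _) (fun c => h₂ _ _ _)
    (fun c n hn₁ hn₂ => hom_ext _ _ (hn₁.trans (h₁ _ _ _).symm) (hn₂.trans (h₂ _ _ _).symm))⟩⟩

-- A kernel is a base change along `0 ⟶ B`, so protomodularity applies to it.
open ZeroObject in
theorem isPullback_of_isKernel [HasZeroObject C] [HasZeroMorphisms C] {X Y B : C}
    {k : X ⟶ Y} {p : Y ⟶ B} (w : k ≫ p = 0) (hk : IsLimit (KernelFork.ofι k w)) :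
    IsPullback k (0 : X ⟶ (0 : C)) p 0 := by
  refine ⟨⟨by simp [w]⟩, ⟨PullbackCone.IsLimit.mk _
    (fun c => (KernelFork.IsLimit.lift' hk c.fst (by simpa using c.condition)).1) ?_ ?_ ?_⟩⟩
  · intro c
    exact (KernelFork.IsLimit.lift' hk c.fst (by simpa using c.condition)).2
  · intro c
    exact (isZero_zero C).eq_of_tgt _ _
  · intro c l h₁ _
    apply Fork.IsLimit.hom_ext hk
    exact h₁.trans (KernelFork.IsLimit.lift' hk c.fst (by simpa using c.condition)).2.symm

theorem isExactPatch_of_isKernel [HasZeroObject C] [HasZeroMorphisms C] [HasEqualizers C]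
    [IsProtomodular C] {X Y B : C} {k : X ⟶ Y} {p : Y ⟶ B} (w : k ≫ p = 0)
    (hk : IsLimit (KernelFork.ofι k w)) {s : B ⟶ Y} (hs : s ≫ p = 𝟙 B) : IsExactPatch k s p where
  jointlyEpic := jointlyEpic_of_isPullback (isPullback_of_isKernel w hk) hs
  s_p := hs
  k_p := w
  isKernel := ⟨hk⟩

end JointlyEpic

theorem comp_pullback_lift {C : Type u} [Category.{v} C] {T S X Y Z : C} {f : X ⟶ Z} {g : Y ⟶ Z}
    [HasPullback f g] (t : T ⟶ S) (x : S ⟶ X) (y : S ⟶ Y) (w : x ≫ f = y ≫ g) :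
    t ≫ pullback.lift x y w = pullback.lift (t ≫ x) (t ≫ y) (by simp [w]) := by
  apply pullback.hom_ext <;> simp [pullback.lift_fst, pullback.lift_snd]

/-! ### Unital multiplications on a reflexive graph -/

namespace ReflexiveGraph

/-- The dashed arrow `X × X ⟶ C₁` for some kernel of the domain makes the graph a Peiffer graph. -/
theorem isPeiffer_of_isKernel {C : Type u} [Category.{v} C] {Γ : ReflexiveGraph C}
    [HasZeroMorphisms C] [HasKernels C] [HasBinaryProducts C] {X : C}
    {k : X ⟶ Γ.C₁} (w : k ≫ Γ.d = 0) (hk : IsLimit (KernelFork.ofι k w)) (φ : X ⨯ X ⟶ Γ.C₁)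
    (hφ₁ : prod.lift (𝟙 X) 0 ≫ φ = k) (hφ₂ : prod.lift (𝟙 X) (𝟙 X) ≫ φ = (k ≫ Γ.c) ≫ Γ.e) :
    Γ.IsPeiffer := by
  obtain ⟨i, hi⟩ : ∃ i : kernel Γ.d ⟶ X, i ≫ k = kernel.ι Γ.d :=
    ⟨_, (KernelFork.IsLimit.lift' hk (kernel.ι Γ.d) (kernel.condition Γ.d)).2⟩
  refine ⟨prod.map i i ≫ φ, ?_, ?_⟩
  · rw [prod.lift_map_assoc, ← hi, Category.id_comp, zero_comp, ← i ≫= hφ₁, ← Category.assoc,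
      prod.comp_lift, Category.comp_id, comp_zero]
  · rw [prod.lift_map_assoc, ← hi, Category.id_comp, Category.assoc, Category.assoc,
      ← Category.assoc k, ← hφ₂, ← Category.assoc, prod.comp_lift, Category.comp_id]

variable {C : Type u} [Category.{v} C] (Γ : ReflexiveGraph C) [HasPullbacks C]

@[simp]
theorem e₁_fst : Γ.e₁ ≫ pullback.fst Γ.d Γ.c = 𝟙 _ := pullback.lift_fst _ _ _

@[simp]
theorem e₁_snd : Γ.e₁ ≫ pullback.snd Γ.d Γ.c = Γ.d ≫ Γ.e := pullback.lift_snd _ _ _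

@[simp]
theorem e₂_fst : Γ.e₂ ≫ pullback.fst Γ.d Γ.c = Γ.c ≫ Γ.e := pullback.lift_fst _ _ _

@[simp]
theorem e₂_snd : Γ.e₂ ≫ pullback.snd Γ.d Γ.c = 𝟙 _ := pullback.lift_snd _ _ _

/-- The morphism `y ↦ (1, y)` is the base change of `(x, y) ↦ x` along the identity morphism. -/
theorem isPullback_e₂ : IsPullback Γ.e₂ Γ.c (pullback.fst Γ.d Γ.c) Γ.e := by
  refine isPullback_of_exists_lift Γ.e₂_fst (fun T x b w => ⟨x ≫ pullback.snd Γ.d Γ.c, ?_, ?_⟩)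
    (fun T a b h _ => ?_)
  · apply pullback.hom_ext
    · rw [Category.assoc, Category.assoc, e₂_fst, ← pullback.condition_assoc, reassoc_of% w,
        reassoc_of% Γ.e_d, w]
    · simp
  · rw [Category.assoc, ← pullback.condition, reassoc_of% w, Γ.e_d, Category.comp_id]
  · simpa using h =≫ pullback.snd Γ.d Γ.c

theorem jointlyEpic_e₂_e₁ [HasEqualizers C] [IsProtomodular C] : JointlyEpic Γ.e₂ Γ.e₁ :=
  jointlyEpic_of_isPullback Γ.isPullback_e₂ Γ.e₁_fst

variable {Γ} {m : pullback Γ.d Γ.c ⟶ Γ.C₁}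

/-- Unit law for generalized elements; the identity factor enters through an equation, so it need
not appear in the form `x ≫ Γ.d ≫ Γ.e`. -/
theorem lift_mul_of_right_eq_id (h₁ : Γ.e₁ ≫ m = 𝟙 _) {T : C} {x u : T ⟶ Γ.C₁}
    (w : x ≫ Γ.d = u ≫ Γ.c) (hu : u = x ≫ Γ.d ≫ Γ.e) : pullback.lift x u w ≫ m = x := by
  have : pullback.lift x u w = x ≫ Γ.e₁ := by
    apply pullback.hom_ext <;> simp [pullback.lift_fst, pullback.lift_snd, hu]
  rw [this, Category.assoc, h₁, Category.comp_id]

theorem lift_mul_of_left_eq_id (h₂ : Γ.e₂ ≫ m = 𝟙 _) {T : C} {u y : T ⟶ Γ.C₁}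
    (w : u ≫ Γ.d = y ≫ Γ.c) (hu : u = y ≫ Γ.c ≫ Γ.e) : pullback.lift u y w ≫ m = y := by
  have : pullback.lift u y w = y ≫ Γ.e₂ := by
    apply pullback.hom_ext <;> simp [pullback.lift_fst, pullback.lift_snd, hu]
  rw [this, Category.assoc, h₂, Category.comp_id]

theorem mul_d [HasEqualizers C] [IsProtomodular C] (h₁ : Γ.e₁ ≫ m = 𝟙 _) (h₂ : Γ.e₂ ≫ m = 𝟙 _) :
    m ≫ Γ.d = pullback.snd Γ.d Γ.c ≫ Γ.d := by
  apply Γ.jointlyEpic_e₂_e₁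
  · rw [reassoc_of% h₂, reassoc_of% Γ.e₂_snd]
  · rw [reassoc_of% h₁, reassoc_of% Γ.e₁_snd, Γ.e_d, Category.comp_id]

theorem mul_c [HasEqualizers C] [IsProtomodular C] (h₁ : Γ.e₁ ≫ m = 𝟙 _) (h₂ : Γ.e₂ ≫ m = 𝟙 _) :
    m ≫ Γ.c = pullback.fst Γ.d Γ.c ≫ Γ.c := by
  apply Γ.jointlyEpic_e₂_e₁
  · rw [reassoc_of% h₂, reassoc_of% Γ.e₂_fst, Γ.e_c, Category.comp_id]
  · rw [reassoc_of% h₁, reassoc_of% Γ.e₁_fst]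

theorem mul_unique [HasEqualizers C] [IsProtomodular C] (h₁ : Γ.e₁ ≫ m = 𝟙 _)
    (h₂ : Γ.e₂ ≫ m = 𝟙 _) {m' : pullback Γ.d Γ.c ⟶ Γ.C₁} (h₁' : Γ.e₁ ≫ m' = 𝟙 _)
    (h₂' : Γ.e₂ ≫ m' = 𝟙 _) : m = m' :=
  Γ.jointlyEpic_e₂_e₁ _ _ (h₂.trans h₂'.symm) (h₁.trans h₁'.symm)

/-! ### Associativity -/

variable (Γ) in
/-- The object of composable triples `(x, y, z)`. -/
noncomputable abbrev composableTriples : C := pullback (pullback.snd Γ.d Γ.c ≫ Γ.d) Γ.c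

variable (Γ) in
/-- `(y, z) ↦ (1, y, z)` -/
noncomputable def insertLeft : pullback Γ.d Γ.c ⟶ Γ.composableTriples :=
  pullback.lift (pullback.fst Γ.d Γ.c ≫ Γ.e₂) (pullback.snd Γ.d Γ.c)
    (by rw [Category.assoc, reassoc_of% Γ.e₂_snd, pullback.condition])

variable (Γ) in
/-- `(x, y) ↦ (x, y, 1)` -/
noncomputable def insertRight : pullback Γ.d Γ.c ⟶ Γ.composableTriples :=
  pullback.lift (𝟙 _) (pullback.snd Γ.d Γ.c ≫ Γ.d ≫ Γ.e) (by simp [Γ.e_c])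

-- Over the pairs `(x, y)`, with `z` forgotten and `insertRight` as section, restricting to `x = 1`
-- leaves the pairs `(y, z)`.
variable (Γ) in
theorem isPullback_insertLeft :
    IsPullback Γ.insertLeft (pullback.fst Γ.d Γ.c)
      (pullback.fst (pullback.snd Γ.d Γ.c ≫ Γ.d) Γ.c) Γ.e₂ := by
  refine isPullback_of_exists_lift (pullback.lift_fst _ _ _) (fun T x y w =>
    ⟨pullback.lift y (x ≫ pullback.snd _ _) ?_, ?_, pullback.lift_fst _ _ _⟩) (fun T a b h h' => ?_)
  · have := w =≫ (pullback.snd Γ.d Γ.c ≫ Γ.d)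
    rw [Category.assoc, pullback.condition, Category.assoc, reassoc_of% Γ.e₂_snd] at this
    rw [Category.assoc, this]
  · apply pullback.hom_ext
    · simp [insertLeft, pullback.lift_fst, pullback.lift_fst_assoc, w]
    · simp [insertLeft, pullback.lift_snd]
  · apply pullback.hom_ext h'
    simpa [insertLeft, pullback.lift_snd] using h =≫ pullback.snd _ _

variable (Γ) in
theorem jointlyEpic_insertLeft_insertRight [HasEqualizers C] [IsProtomodular C] :
    JointlyEpic Γ.insertLeft Γ.insertRight :=
  jointlyEpic_of_isPullback Γ.isPullback_insertLeft (pullback.lift_fst _ _ _)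

/-- Allows rewriting the factors of a product although the composability proof depends on them. -/
theorem lift_mul_congr {T : C} {x x' y y' : T ⟶ Γ.C₁} {w : x ≫ Γ.d = y ≫ Γ.c} (hx : x = x')
    (hy : y = y') :
    pullback.lift x y w ≫ m = pullback.lift x' y' (by rw [← hx, ← hy, w]) ≫ m := by
  subst hx hy
  rfl

theorem comp_lift_mul {S T : C} (t : S ⟶ T) {x y : T ⟶ Γ.C₁} {w : x ≫ Γ.d = y ≫ Γ.c} :
    t ≫ pullback.lift x y w ≫ m = pullback.lift (t ≫ x) (t ≫ y) (by simp [w]) ≫ m := by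
  rw [← Category.assoc, comp_pullback_lift]

theorem lift_fst_snd_mul :
    pullback.lift (pullback.fst Γ.d Γ.c) (pullback.snd Γ.d Γ.c) pullback.condition ≫ m = m := by
  rw [show pullback.lift (pullback.fst Γ.d Γ.c) (pullback.snd Γ.d Γ.c) pullback.condition = 𝟙 _ by
    apply pullback.hom_ext
    · rw [pullback.lift_fst, Category.id_comp]
    · rw [pullback.lift_snd, Category.id_comp], Category.id_comp]

/-- By the unit laws both sides are `y z` on `(1, y, z)` and `x y` on `(x, y, 1)`, and these triples
are jointly epic. -/
theorem mul_assoc_universal [HasEqualizers C] [IsProtomodular C] (h₁ : Γ.e₁ ≫ m = 𝟙 _)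
    (h₂ : Γ.e₂ ≫ m = 𝟙 _) (w w₁ w₂) :
    (pullback.lift (pullback.fst (pullback.snd Γ.d Γ.c ≫ Γ.d) Γ.c ≫ m) (pullback.snd _ _) w ≫ m :
        Γ.composableTriples ⟶ Γ.C₁) =
      pullback.lift (pullback.fst _ _ ≫ pullback.fst Γ.d Γ.c)
        (pullback.lift (pullback.fst _ _ ≫ pullback.snd Γ.d Γ.c) (pullback.snd _ _) w₁ ≫ m) w₂
        ≫ m := by
  have hd := mul_d h₁ h₂
  have hc := mul_c h₁ h₂
  have l₁ : Γ.insertLeft ≫ pullback.fst _ _ = pullback.fst Γ.d Γ.c ≫ Γ.e₂ := pullback.lift_fst _ _ _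
  have l₂ : Γ.insertLeft ≫ pullback.snd _ _ = pullback.snd Γ.d Γ.c := pullback.lift_snd _ _ _
  have r₁ : Γ.insertRight ≫ pullback.fst _ _ = 𝟙 _ := pullback.lift_fst _ _ _
  have r₂ : Γ.insertRight ≫ pullback.snd _ _ = pullback.snd Γ.d Γ.c ≫ Γ.d ≫ Γ.e :=
    pullback.lift_snd _ _ _
  apply Γ.jointlyEpic_insertLeft_insertRight
  · trans m
    · refine ((comp_lift_mul _).trans (lift_mul_congr ?_ l₂)).trans lift_fst_snd_mul
      rw [reassoc_of% l₁, h₂, Category.comp_id]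
    · have hm : Γ.insertLeft ≫ pullback.lift (pullback.fst _ _ ≫ pullback.snd Γ.d Γ.c)
          (pullback.snd _ _) w₁ ≫ m = m := by
        refine ((comp_lift_mul _).trans (lift_mul_congr ?_ l₂)).trans lift_fst_snd_mul
        rw [reassoc_of% l₁, e₂_snd, Category.comp_id]
      refine ((comp_lift_mul _).trans ((lift_mul_congr rfl hm).trans
        (lift_mul_of_left_eq_id h₂ _ ?_))).symm
      rw [reassoc_of% l₁, e₂_fst, reassoc_of% hc]
  · trans m
    · refine (comp_lift_mul _).trans ((lift_mul_congr (x' := m) ?_ r₂).trans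
        (lift_mul_of_right_eq_id h₁ _ ?_))
      · rw [reassoc_of% r₁]
      · rw [reassoc_of% hd]
    · refine ((comp_lift_mul _).trans ((lift_mul_congr ?_ ?_).trans lift_fst_snd_mul)).symm
      · rw [reassoc_of% r₁]
      · refine (comp_lift_mul _).trans ((lift_mul_congr ?_ r₂).trans
          (lift_mul_of_right_eq_id h₁ (by simp [Γ.e_c]) rfl))
        rw [reassoc_of% r₁]

theorem lift_mul_assoc [HasEqualizers C] [IsProtomodular C] (h₁ : Γ.e₁ ≫ m = 𝟙 _)
    (h₂ : Γ.e₂ ≫ m = 𝟙 _) {T : C} (x y z : T ⟶ Γ.C₁) (hxy : x ≫ Γ.d = y ≫ Γ.c)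
    (hyz : y ≫ Γ.d = z ≫ Γ.c) (w w') :
    pullback.lift (pullback.lift x y hxy ≫ m) z w ≫ m =
      pullback.lift x (pullback.lift y z hyz ≫ m) w' ≫ m := by
  let t : T ⟶ Γ.composableTriples :=
    pullback.lift (pullback.lift x y hxy) z (by rw [pullback.lift_snd_assoc, hyz])
  have t₁ : t ≫ pullback.fst _ _ = pullback.lift x y hxy := pullback.lift_fst _ _ _
  have t₂ : t ≫ pullback.snd _ _ = z := pullback.lift_snd _ _ _
  have h := t ≫= mul_assoc_universal h₁ h₂
    (by rw [Category.assoc, mul_d h₁ h₂, pullback.condition])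
    (by rw [Category.assoc, pullback.condition])
    (by rw [Category.assoc, Category.assoc, mul_c h₁ h₂, pullback.lift_fst_assoc,
      pullback.condition, Category.assoc])
  rw [comp_lift_mul, comp_lift_mul] at h
  refine Eq.trans (lift_mul_congr ?_ t₂.symm) (h.trans (lift_mul_congr ?_ ?_))
  · rw [reassoc_of% t₁]
  · rw [reassoc_of% t₁, pullback.lift_fst]
  · refine (comp_lift_mul _).trans (lift_mul_congr ?_ t₂)
    rw [reassoc_of% t₁, pullback.lift_snd]

/-! ### Inverses and uniqueness of the groupoid structure -/

variable (Γ) in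
/-- The base change along the identity morphism of the projection `(x, z) ↦ x` of the object of
pairs with a common codomain. -/
theorem isPullback_lift_c_e :
    IsPullback (pullback.lift (Γ.c ≫ Γ.e) (𝟙 Γ.C₁) (by simp [Γ.e_c])) Γ.c
      (pullback.fst Γ.c Γ.c) Γ.e := by
  refine isPullback_of_exists_lift (pullback.lift_fst _ _ _)
    (fun T x b w => ⟨x ≫ pullback.snd Γ.c Γ.c, ?_, ?_⟩) (fun T a b h _ => ?_)
  · apply pullback.hom_ext
    · rw [Category.assoc, Category.assoc, pullback.lift_fst, ← pullback.condition_assoc,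
        reassoc_of% w, reassoc_of% Γ.e_c, w]
    · simp [pullback.lift_snd]
  · rw [Category.assoc, ← pullback.condition, reassoc_of% w, Γ.e_c, Category.comp_id]
  · simpa [pullback.lift_snd] using h =≫ pullback.snd Γ.c Γ.c

/-- The shear morphism `(x, y) ↦ (x, x y)` of a unital multiplication is invertible. -/
theorem isIso_shear [IsProtomodular C] (h₁ : Γ.e₁ ≫ m = 𝟙 _) (h₂ : Γ.e₂ ≫ m = 𝟙 _)
    (w : pullback.fst Γ.d Γ.c ≫ Γ.c = m ≫ Γ.c) :
    IsIso (pullback.lift (pullback.fst Γ.d Γ.c) m w : _ ⟶ pullback Γ.c Γ.c) :=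
  -- Over the first coordinate `x`, the shear carries the section `(x, 1)` to the diagonal. Both
  -- base changes along `e` are `C₁`, and there the shear is `y ↦ 1 y = y`.
  IsProtomodular.isIso_of_baseChange Γ.e (pullback.fst Γ.d Γ.c) Γ.e₁ (pullback.fst Γ.c Γ.c)
    (pullback.lift (𝟙 _) (𝟙 _) rfl) _ Γ.e₂ Γ.c _ Γ.c (𝟙 _) Γ.e₁_fst (pullback.lift_fst _ _ _)
    (pullback.lift_fst _ _ _)
    (by apply pullback.hom_ext <;> simp [pullback.lift_fst, pullback.lift_snd, h₁])
    Γ.isPullback_e₂ Γ.isPullback_lift_c_e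
    (by apply pullback.hom_ext <;> simp [pullback.lift_fst, pullback.lift_snd, h₂])
    (Category.id_comp _) inferInstance

theorem lift_mul_left_cancel [HasEqualizers C] [IsProtomodular C] (h₁ : Γ.e₁ ≫ m = 𝟙 _)
    (h₂ : Γ.e₂ ≫ m = 𝟙 _) {T : C} {x y y' : T ⟶ Γ.C₁} {w : x ≫ Γ.d = y ≫ Γ.c}
    {w' : x ≫ Γ.d = y' ≫ Γ.c} (h : pullback.lift x y w ≫ m = pullback.lift x y' w' ≫ m) :
    y = y' := by
  have := isIso_shear h₁ h₂ (mul_c h₁ h₂).symm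
  have key : pullback.lift x y w = pullback.lift x y' w' := by
    rw [← cancel_mono (pullback.lift (pullback.fst Γ.d Γ.c) m (mul_c h₁ h₂).symm :
      _ ⟶ pullback Γ.c Γ.c)]
    apply pullback.hom_ext <;> simp [pullback.lift_fst, pullback.lift_snd, h]
  simpa [pullback.lift_snd] using key =≫ pullback.snd Γ.d Γ.c

theorem exists_right_inverse [HasEqualizers C] [IsProtomodular C] (h₁ : Γ.e₁ ≫ m = 𝟙 _)
    (h₂ : Γ.e₂ ≫ m = 𝟙 _) : ∃ (i : Γ.C₁ ⟶ Γ.C₁) (_ : i ≫ Γ.d = Γ.c) (hc : i ≫ Γ.c = Γ.d),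
      pullback.lift (𝟙 _) i (by simp [hc]) ≫ m = Γ.c ≫ Γ.e := by
  have := isIso_shear h₁ h₂ (mul_c h₁ h₂).symm
  -- The inverse shear applied to `(x, 1)` gives `(x, x⁻¹)`.
  obtain ⟨θ, hθ⟩ : ∃ θ : Γ.C₁ ⟶ pullback Γ.d Γ.c, θ ≫ pullback.lift (pullback.fst Γ.d Γ.c) m
      (mul_c h₁ h₂).symm = pullback.lift (𝟙 _) (Γ.c ≫ Γ.e) (by simp [Γ.e_c]) :=
    ⟨_ ≫ inv _, by rw [Category.assoc, IsIso.inv_hom_id, Category.comp_id]⟩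
  have hθ₁ : θ ≫ pullback.fst Γ.d Γ.c = 𝟙 _ := by
    simpa [pullback.lift_fst] using hθ =≫ pullback.fst Γ.c Γ.c
  have hθ₂ : θ ≫ m = Γ.c ≫ Γ.e := by
    simpa [pullback.lift_snd] using hθ =≫ pullback.snd Γ.c Γ.c
  have hd : (θ ≫ pullback.snd Γ.d Γ.c) ≫ Γ.d = Γ.c := by
    rw [Category.assoc, ← mul_d h₁ h₂, reassoc_of% hθ₂, Γ.e_d, Category.comp_id]
  have hc : (θ ≫ pullback.snd Γ.d Γ.c) ≫ Γ.c = Γ.d := by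
    rw [Category.assoc, ← pullback.condition, reassoc_of% hθ₁]
  refine ⟨_, hd, hc, ?_⟩
  rw [← hθ₂]
  congr 1
  apply pullback.hom_ext <;> simp [pullback.lift_fst, pullback.lift_snd, hθ₁]

/-- In a protomodular category a multiplicative graph is an internal groupoid. -/
theorem IsMultiplicative.nonempty_groupoidStr [HasEqualizers C] [IsProtomodular C]
    (h : Γ.IsMultiplicative) : Nonempty Γ.GroupoidStr := by
  obtain ⟨m, h₁, h₂⟩ := h
  obtain ⟨i, hd, hc, hi⟩ := exists_right_inverse h₁ h₂
  refine ⟨⟨m, i, mul_d h₁ h₂, mul_c h₁ h₂, h₁, h₂,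
    fun x y z hxy hyz => lift_mul_assoc h₁ h₂ x y z hxy hyz _ _, hd, hc, ?_, hi⟩⟩
  have w : 𝟙 _ ≫ Γ.d = (pullback.lift i (𝟙 Γ.C₁) (by simp [hd]) ≫ m) ≫ Γ.c := by
    rw [Category.assoc, mul_c h₁ h₂, pullback.lift_fst_assoc, hc, Category.id_comp]
  -- The right inverse is also a left inverse: cancel `x` in `x (x⁻¹ x) = (x x⁻¹) x = x = x 1`.
  refine lift_mul_left_cancel h₁ h₂ (w := w) (w' := by simp [Γ.e_c]) ?_
  rw [lift_mul_of_right_eq_id h₁ _ (Category.id_comp _).symm,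
    ← lift_mul_assoc h₁ h₂ (𝟙 _) i (𝟙 _) (by simp [hc]) (by simp [hd])
      (by rw [Category.assoc, mul_d h₁ h₂, pullback.lift_snd_assoc, hd, Category.id_comp]),
    lift_mul_of_left_eq_id h₂]
  rw [hi, Category.id_comp]

/-- The unit laws determine `m`; left cancellation in `x x⁻¹ = 1` then determines the inverse. -/
theorem GroupoidStr.subsingleton [HasEqualizers C] [IsProtomodular C] :
    Subsingleton Γ.GroupoidStr := by
  refine ⟨fun S S' => ?_⟩
  have hm : S.m = S'.m := mul_unique S.e₁_m S.e₂_m S'.e₁_m S'.e₂_m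
  refine GroupoidStr.ext hm (lift_mul_left_cancel S.e₁_m S.e₂_m
    (x := 𝟙 _) (w := by simp [S.inv_c]) (w' := by simp [S'.inv_c]) ?_)
  rw [S.m_inv, hm, S'.m_inv]

/-- The second dashed arrow is `⟨c, d⟩`, the first is `(x, y) ↦ x y⁻¹`. -/
theorem GroupoidStr.hasDashedArrows [HasZeroMorphisms C] [HasBinaryProducts C]
    (S : Γ.GroupoidStr) {X : C} {k : X ⟶ Γ.C₁} (hk : k ≫ Γ.d = 0) :
    HasDashedArrows k Γ.e (k ≫ Γ.c) := by
  have e_inv : Γ.e ≫ S.inv = Γ.e := by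
    have h := Γ.e ≫= S.m_inv
    rw [reassoc_of% Γ.e_c, comp_lift_mul, lift_mul_of_left_eq_id S.e₂_m] at h
    · exact h
    · rw [Category.assoc, reassoc_of% S.inv_c, reassoc_of% Γ.e_d, Category.comp_id]
  refine ⟨⟨pullback.lift (prod.fst ≫ k) (prod.snd ≫ k ≫ S.inv) (by simp [hk, S.inv_c]) ≫ S.m,
    ?_, ?_⟩, ⟨prod.lift Γ.c Γ.d, ?_, ?_⟩⟩
  · rw [comp_lift_mul, lift_mul_of_right_eq_id S.e₁_m]
    · rw [prod.lift_fst_assoc, Category.id_comp]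
    · rw [prod.lift_snd_assoc, prod.lift_fst_assoc, Category.id_comp, reassoc_of% hk, zero_comp,
        zero_comp]
  · refine (comp_lift_mul _).trans (.trans ?_ (Category.assoc _ _ _).symm)
    rw [← S.m_inv, comp_lift_mul]
    apply lift_mul_congr <;> simp [prod.lift_fst_assoc, prod.lift_snd_assoc]
  · ext <;> simp [prod.lift_fst, prod.lift_snd, hk]
  · ext <;> simp [prod.lift_fst, prod.lift_snd, Γ.e_c, Γ.e_d]

end ReflexiveGraph

/-! ### Groupoids versus exact patches with dashed arrows -/

section Normalization

variable {C : Type u} [Category.{v} C] [HasZeroMorphisms C] [HasFiniteLimits C] [IsProtomodular C]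

theorem exists_groupoidStr_of_hasDashedArrows
    (hPeiffer : ∀ Γ : ReflexiveGraph C, Γ.IsPeiffer → Γ.IsMultiplicative)
    {X Y B : C} {k : X ⟶ Y} {s : B ⟶ Y} {p : Y ⟶ B} (hp : IsExactPatch k s p) {h : X ⟶ B}
    (hD : HasDashedArrows k s h) : ∃ (c : Y ⟶ B) (hc : s ≫ c = 𝟙 B), k ≫ c = h ∧
      Nonempty (ReflexiveGraph.GroupoidStr ⟨B, Y, p, c, s, hp.s_p, hc⟩) := by
  obtain ⟨⟨φ, hφ₁, hφ₂⟩, ψ, hψ₁, hψ₂⟩ := hD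
  have hc : s ≫ ψ ≫ prod.fst = 𝟙 B := by simpa [prod.lift_fst] using hψ₂ =≫ prod.fst
  have hk : k ≫ ψ ≫ prod.fst = h := by simpa [prod.lift_fst] using hψ₁ =≫ prod.fst
  refine ⟨ψ ≫ prod.fst, hc, hk, ?_⟩
  refine (hPeiffer _ (ReflexiveGraph.isPeiffer_of_isKernel (k := k) hp.k_p hp.isKernel.some φ hφ₁
    ?_)).nonempty_groupoidStr
  rw [hφ₂, hk]

theorem exists_iso_normalization
    (hPeiffer : ∀ Γ : ReflexiveGraph C, Γ.IsPeiffer → Γ.IsMultiplicative)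
    (D : CospanWithMap C) (hD : CospanWithMap.isPeifferPatch C D) :
    ∃ G : InternalGroupoid C, Nonempty ((normalization C).obj G ≅ D) := by
  obtain ⟨⟨p, hp⟩, hD⟩ := hD
  obtain ⟨c, hc, hk, ⟨S⟩⟩ := exists_groupoidStr_of_hasDashedArrows hPeiffer hp hD
  -- `D.X` is some kernel of `p`, while normalization uses the chosen one; their comparison is the
  -- only nonidentity component of the isomorphism.
  let i : kernel p ≅ D.X := (kernelIsKernel p).conePointUniqueUpToIso hp.isKernel.some
  have hi : i.hom ≫ D.k = kernel.ι p :=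
    (kernelIsKernel p).conePointUniqueUpToIso_hom_comp hp.isKernel.some WalkingParallelPair.zero
  have hi' : i.inv ≫ kernel.ι p = D.k := by rw [← hi, i.inv_hom_id_assoc]
  refine ⟨⟨_, S⟩, ⟨⟨⟨i.hom, 𝟙 _, 𝟙 _, ?_, ?_, ?_⟩, ⟨i.inv, 𝟙 _, 𝟙 _, ?_, ?_, ?_⟩, ?_, ?_⟩⟩⟩
  · exact (Category.comp_id _).trans hi.symm
  · exact (Category.comp_id _).trans (Category.id_comp _).symm
  · change (kernel.ι p ≫ c) ≫ 𝟙 _ = i.hom ≫ D.h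
    rw [Category.comp_id, ← hk, reassoc_of% hi]
  · exact (Category.comp_id _).trans hi'.symm
  · exact (Category.comp_id _).trans (Category.id_comp _).symm
  · change D.h ≫ 𝟙 _ = i.inv ≫ kernel.ι p ≫ c
    rw [Category.comp_id, ← hk, reassoc_of% hi']
  · exact CospanWithMap.Hom.ext i.hom_inv_id (Category.comp_id _) (Category.comp_id _)
  · exact CospanWithMap.Hom.ext i.inv_hom_id (Category.comp_id _) (Category.comp_id _)

variable [HasZeroObject C]

namespace InternalGroupoid

theorem isExactPatch (G : InternalGroupoid C) : IsExactPatch (kernel.ι G.d) G.e G.d :=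
  isExactPatch_of_isKernel (kernel.condition G.d) (kernelIsKernel G.d) G.e_d

theorem isPeifferPatch_normalization (G : InternalGroupoid C) :
    CospanWithMap.isPeifferPatch C ((normalization C).obj G) :=
  ⟨⟨G.d, G.isExactPatch⟩, G.str.hasDashedArrows (kernel.condition G.d)⟩

instance : (normalization C).Faithful where
  map_injective h :=
    Hom.ext (congrArg CospanWithMap.Hom.fB h) (congrArg CospanWithMap.Hom.fY h)

/-- A morphism of the underlying split epimorphisms compatible with the normalizations is an
internal functor. -/
def homOfComm {G H : InternalGroupoid C} (fX : kernel G.d ⟶ kernel H.d) (f₁ : G.C₁ ⟶ H.C₁)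
    (f₀ : G.C₀ ⟶ H.C₀) (hk : kernel.ι G.d ≫ f₁ = fX ≫ kernel.ι H.d) (hs : G.e ≫ f₁ = f₀ ≫ H.e)
    (hh : (kernel.ι G.d ≫ G.c) ≫ f₀ = fX ≫ kernel.ι H.d ≫ H.c) : Hom G H :=
  have hd : f₁ ≫ H.d = G.d ≫ f₀ := by
    apply G.isExactPatch.jointlyEpic
    · rw [reassoc_of% hk, kernel.condition, kernel.condition_assoc, comp_zero, zero_comp]
    · rw [reassoc_of% hs, H.e_d, reassoc_of% G.e_d, Category.comp_id]
  have hc : f₁ ≫ H.c = G.c ≫ f₀ := by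
    apply G.isExactPatch.jointlyEpic
    · rw [reassoc_of% hk, ← hh, Category.assoc]
    · rw [reassoc_of% hs, H.e_c, reassoc_of% G.e_c, Category.comp_id]
  { f₀ := f₀
    f₁ := f₁
    comm_d := hd
    comm_c := hc
    comm_e := hs
    comm_m := by
      -- On `(1, y)` and `(x, 1)`, preservation of products reduces to preservation of identities.
      apply G.jointlyEpic_e₂_e₁
      · rw [reassoc_of% G.str.e₂_m, ReflexiveGraph.comp_lift_mul,
          ReflexiveGraph.lift_mul_of_left_eq_id H.str.e₂_m]
        · rw [reassoc_of% G.e₂_snd]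
        · rw [reassoc_of% G.e₂_fst, reassoc_of% G.e₂_snd, hs, reassoc_of% hc]
      · rw [reassoc_of% G.str.e₁_m, ReflexiveGraph.comp_lift_mul,
          ReflexiveGraph.lift_mul_of_right_eq_id H.str.e₁_m]
        · rw [reassoc_of% G.e₁_fst]
        · rw [reassoc_of% G.e₁_fst, reassoc_of% G.e₁_snd, hs, reassoc_of% hd] }

instance : (normalization C).Full where
  map_surjective {G H} f := by
    refine ⟨homOfComm f.fX f.fY f.fB f.comm_k f.comm_s f.comm_h, CospanWithMap.Hom.ext ?_ rfl rfl⟩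
    refine (cancel_mono (kernel.ι H.d)).1 ?_
    exact (kernel.lift_ι _ _ _).trans f.comm_k

end InternalGroupoid

end Normalization

end PtProto

open PtProto
/-- In a pointed protomodular category where every Peiffer graph is multiplicative, internal
groupoids are the same as exact patches `(k, s)` with a morphism `h` admitting the two dashed
arrows: (1) the functor `G ↦ (ker d, e, c ∘ ker d)` corestricts to an equivalence of categories
onto the category of such data; (2) for a given exact patch `(k, s)` with retraction `p`, and `h`,
the dashed arrows exist if and only if there is a groupoid with domain `p`, identities `s` and
codomain `c` such that `c k = h`, and then `c` and the groupoid structure are unique. -/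
theorem mainTheorem6 {C : Type u} [Category.{v} C] [HasZeroObject C] [HasZeroMorphisms C]
    [HasFiniteLimits C] [IsProtomodular C]
    (hPeiffer : ∀ Γ : ReflexiveGraph C, Γ.IsPeiffer → Γ.IsMultiplicative) :
    (∃ hN : ∀ G : InternalGroupoid C,
        CospanWithMap.isPeifferPatch C ((normalization C).obj G),
      ((CospanWithMap.isPeifferPatch C).lift (normalization C) hN).IsEquivalence) ∧
    (∀ {X Y B : C} (k : X ⟶ Y) (s : B ⟶ Y) (p : Y ⟶ B) (hp : IsExactPatch k s p) (h : X ⟶ B),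
      (HasDashedArrows k s h →
        ∃! c : Y ⟶ B, ∃ hc : s ≫ c = 𝟙 B, k ≫ c = h ∧
          ∃! _S : ReflexiveGraph.GroupoidStr ⟨B, Y, p, c, s, hp.s_p, hc⟩, True) ∧
      ((∃ (c : Y ⟶ B) (hc : s ≫ c = 𝟙 B), k ≫ c = h ∧
          Nonempty (ReflexiveGraph.GroupoidStr ⟨B, Y, p, c, s, hp.s_p, hc⟩)) →
        HasDashedArrows k s h)) := by
  refine ⟨⟨InternalGroupoid.isPeifferPatch_normalization, ?_⟩, fun {X Y B} k s p hp h => ⟨?_, ?_⟩⟩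
  · have : ((CospanWithMap.isPeifferPatch C).lift (normalization C)
        InternalGroupoid.isPeifferPatch_normalization).EssSurj := by
      refine ⟨fun D => ?_⟩
      obtain ⟨G, ⟨i⟩⟩ := exists_iso_normalization hPeiffer D.obj D.property
      exact ⟨G, ⟨ObjectProperty.isoMk _ i⟩⟩
    exact { }
  · intro hD
    obtain ⟨c, hc, hk, ⟨S⟩⟩ := exists_groupoidStr_of_hasDashedArrows hPeiffer hp hD
    refine ⟨c, ⟨hc, hk, S, trivial, fun S' _ =>
      ReflexiveGraph.GroupoidStr.subsingleton.elim S' S⟩, ?_⟩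
    rintro c' ⟨hc', hk', -⟩
    -- A codomain is prescribed on both `k` and `s`, hence unique.
    exact hp.jointlyEpic _ _ (hk'.trans hk.symm) (hc'.trans hc.symm)
  · rintro ⟨c, hc, rfl, ⟨S⟩⟩
    exact S.hasDashedArrows hp.k_p
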